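/- Let $P$ and $M$ be connected paracompact (Hausdorff, finite-dimensional) smooth manifolds and let $p\colon P\to M$ be a smooth principal bundle with structure group a Lie group $G$ acting smoothly from the left on $P$. Let $\omega$ be a flat connection on $P(M,G)$, i.e. a connection form such that every point of $M$ has a neighbourhood $U$ over which $P$ with $\omega$ is isomorphic to the product bundle $U\times G$ with its canonical flat connection. Let $q\colon\hat M\to M$ be a smooth covering, let $\hat P=\{(m,x)\in\hat M\times P: q(m)=p(x)\}$ be the induced principal bundle, with projections $\hat p\colon\hat P\to\hat M$ and $\hat q\colon\hat P\to P$, and let $\hat\omega=\hat q^{*}\omega$ be the induced connection. Fix $\hat x_0\in\hat P$ and put $x_0=\hat q(\hat x_0)$. Then $\hat\omega$ is flat, and the holonomy morphisms $h_\omega\colon\pi_1(M,p(x_0))\to G$ and $h_{\hat\omega}\colon\pi_1(\hat M,\hat p(\hat x_0))\to G$ are well defined: there is exactly one homomorphism $h_\omega$ such that every piecewise smooth loop $w$ at $p(x_0)$ has a horizontal lift (a piecewise smooth path in $P$ over $w$ whose velocity is annihilated by $\omega$) starting at $x_0$, and every such lift ends at $h_\omega([w])\,x_0$; and likewise for $h_{\hat\omega}$,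 with $\hat\omega$ and $\hat x_0$. Here the product in $\pi_1$ is $[w][w']=[w\text{ followed by }w']$. Moreover $$h_{\hat\omega}=h_\omega\circ q_{\#},$$ where $q_{\#}\colon\pi_1(\hat M,\hat p(\hat x_0))\to\pi_1(M,p(x_0))$ is the homomorphism induced by $q$. -/

import Mathlib

open Set
open scoped Manifold ContDiff Topology

noncomputable section

namespace FlatHolonomy

/-! ### Principal bundles with a left action -/

section Bundle

variable (EG : Type*) [NormedAddCommGroup EG] [NormedSpace ℝ EG]
  {G : Type*} [TopologicalSpace G] [ChartedSpace EG G] [Group G]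
  (EP : Type*) [NormedAddCommGroup EP] [NormedSpace ℝ EP]
  {P : Type*} [TopologicalSpace P] [ChartedSpace EP P] [MulAction G P]
  (EM : Type*) [NormedAddCommGroup EM] [NormedSpace ℝ EM]
  {M : Type*} [TopologicalSpace M] [ChartedSpace EM M]

/-- A local trivialization `p⁻¹(U) ≃ U × G` of `p : P → M` is a smooth principal trivialization if
it is a diffeomorphism and carries the left action of `G` to left multiplication on the fibre. -/
structure IsPrincipalTrivialization {proj : P → M} (e : Bundle.Trivialization G proj) : Prop where
  smooth : ContMDiffOn 𝓘(ℝ, EP) (𝓘(ℝ, EM).prod 𝓘(ℝ, EG)) ∞ e e.source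
  smooth_symm : ContMDiffOn (𝓘(ℝ, EM).prod 𝓘(ℝ, EG)) 𝓘(ℝ, EP) ∞
    e.toOpenPartialHomeomorph.symm e.target
  map_smul : ∀ (g : G), ∀ x ∈ e.source, (e (g • x)).2 = g * (e x).2

variable (G P M)

/-- A smooth principal bundle `P(M, G)`, where `G` acts smoothly from the left on `P`. -/
structure PrincipalBundle where
  proj : P → M
  smooth_smul : ContMDiff (𝓘(ℝ, EG).prod 𝓘(ℝ, EP)) 𝓘(ℝ, EP) ∞ (fun z : G × P => z.1 • z.2)
  smooth_proj : ContMDiff 𝓘(ℝ, EP) 𝓘(ℝ, EM) ∞ proj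
  proj_smul : ∀ (g : G) (x : P), proj (g • x) = proj x
  locally_trivial : ∀ m : M, ∃ e : Bundle.Trivialization G proj,
    m ∈ e.baseSet ∧ IsPrincipalTrivialization EG EP EM e

end Bundle

/-! ### Connection forms, flatness, horizontal lifts and holonomy -/

section Connection

variable {EG : Type*} [NormedAddCommGroup EG] [NormedSpace ℝ EG]
  {G : Type*} [TopologicalSpace G] [ChartedSpace EG G] [Group G]
  {EP : Type*} [NormedAddCommGroup EP] [NormedSpace ℝ EP]
  {P : Type*} [TopologicalSpace P] [ChartedSpace EP P] [MulAction G P]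
  {EM : Type*} [NormedAddCommGroup EM] [NormedSpace ℝ EM]
  {M : Type*} [TopologicalSpace M] [ChartedSpace EM M]

variable (EG) in
/-- The adjoint representation `Ad g`, the derivative at `1` of `h ↦ g h g⁻¹`. -/
def Ad (g : G) (A : GroupLieAlgebra 𝓘(ℝ, EG) G) : GroupLieAlgebra 𝓘(ℝ, EG) G :=
  mfderiv 𝓘(ℝ, EG) 𝓘(ℝ, EG) (fun h : G => g * h * g⁻¹) 1 A

/-- A connection on a principal bundle, given by its connection form: a smooth 1-form on `P` with
values in the Lie algebra of `G`, which sends every fundamental vector field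
`A*_x = d/dt (exp (t A) • x)` to `A`, and satisfies `(L_g)^* θ = Ad g ∘ θ`. -/
structure ConnectionForm [IsManifold 𝓘(ℝ, EP) ∞ P] (π : PrincipalBundle EG G EP P EM M) where
  form : ∀ x : P, TangentSpace 𝓘(ℝ, EP) x →L[ℝ] GroupLieAlgebra 𝓘(ℝ, EG) G
  smooth : ContMDiff (M' := EG) 𝓘(ℝ, EP).tangent 𝓘(ℝ, EG) ∞
    (fun v : TangentBundle 𝓘(ℝ, EP) P => form v.1 v.2)
  fundamental : ∀ (x : P) (A : GroupLieAlgebra 𝓘(ℝ, EG) G),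
    form ((1 : G) • x) (mfderiv 𝓘(ℝ, EG) 𝓘(ℝ, EP) (fun g : G => g • x) 1 A) = A
  equivariant : ∀ (g : G) (x : P) (v : TangentSpace 𝓘(ℝ, EP) x),
    form (g • x) (mfderiv 𝓘(ℝ, EP) 𝓘(ℝ, EP) (fun y : P => g • y) x v) = Ad EG g (form x v)

variable [IsManifold 𝓘(ℝ, EP) ∞ P] {π : PrincipalBundle EG G EP P EM M}

/-- A connection is flat if every point of the base has a neighbourhood `U` over which it is
isomorphic to the canonical flat connection of `U × G`, i.e. if there is a smooth principal
trivialization over `U` that carries the horizontal subspaces (the kernels of the connection form)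
to the tangent spaces of the slices `U × {a}`. -/
def ConnectionForm.IsFlat (θ : ConnectionForm π) : Prop :=
  ∀ m : M, ∃ e : Bundle.Trivialization G π.proj,
    m ∈ e.baseSet ∧ IsPrincipalTrivialization EG EP EM e ∧
    ∀ x ∈ e.source, ∀ v : TangentSpace 𝓘(ℝ, EP) x,
      θ.form x v = 0 ↔ mfderiv 𝓘(ℝ, EP) 𝓘(ℝ, EG) (fun y : P => (e y).2) x v = 0

/-- A (continuous) path in a manifold is piecewise smooth if `[0, 1]` has a finite partition such
that the path is smooth, up to the end points, on each of the closed subintervals. -/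
def IsPiecewiseSmooth (E : Type*) [NormedAddCommGroup E] [NormedSpace ℝ E]
    {X : Type*} [TopologicalSpace X] [ChartedSpace E X] {x y : X} (γ : Path x y) : Prop :=
  ∃ (n : ℕ) (t : ℕ → ℝ), Monotone t ∧ t 0 = 0 ∧ t n = 1 ∧
    ∀ i < n, ContMDiffOn 𝓘(ℝ, ℝ) 𝓘(ℝ, E) ∞ γ.extend (Icc (t i) (t (i + 1)))

/-- `γ` is a horizontal lift of `w`: it is piecewise smooth, lies over `w`, and its velocity is
annihilated by the connection form wherever it exists. -/
structure ConnectionForm.IsHorizontalLift (θ : ConnectionForm π) {m m' : M} (w : Path m m')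
    {x y : P} (γ : Path x y) : Prop where
  piecewiseSmooth : IsPiecewiseSmooth EP γ
  lifts : ∀ t, π.proj (γ t) = w t
  horizontal : ∀ s ∈ Ioo (0 : ℝ) 1, MDifferentiableAt 𝓘(ℝ, ℝ) 𝓘(ℝ, EP) γ.extend s →
    θ.form (γ.extend s) (mfderiv 𝓘(ℝ, ℝ) 𝓘(ℝ, EP) γ.extend s (1 : ℝ)) = 0

/-- The fundamental group with `[w] * [w'] = [w followed by w']`. (The product of Mathlib's
`FundamentalGroup` is the opposite one.) -/
abbrev PiOne (X : Type*) [TopologicalSpace X] (x : X) : Type _ := (FundamentalGroup X x)ᵐᵒᵖ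

/-- The class of a loop. -/
def PiOne.mk {X : Type*} [TopologicalSpace X] {x : X} (w : Path x x) : PiOne X x :=
  MulOpposite.op (FundamentalGroup.fromPath (Path.Homotopic.Quotient.mk w))

/-- The homomorphism of fundamental groups induced by a continuous map, `[w] ↦ [f ∘ w]`. -/
def PiOne.map {X Y : Type*} [TopologicalSpace X] [TopologicalSpace Y] (f : C(X, Y)) (x : X) :
    PiOne X x →* PiOne Y (f x) :=
  MonoidHom.op (FundamentalGroup.map f x)

/-- `h` is the holonomy morphism of the connection `θ` with respect to the point `x₀` over `m₀`:
every piecewise smooth loop `w` at `m₀` has a horizontal lift starting at `x₀`, and every such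
lift ends at `h [w] • x₀`. -/
def ConnectionForm.IsHolonomy (θ : ConnectionForm π) (x₀ : P) (m₀ : M) (h : PiOne M m₀ →* G) :
    Prop :=
  ∀ w : Path m₀ m₀, IsPiecewiseSmooth EM w →
    (∃ γ : Path x₀ (h (PiOne.mk w) • x₀), θ.IsHorizontalLift w γ) ∧
    ∀ (y : P) (γ : Path x₀ y), θ.IsHorizontalLift w γ → y = h (PiOne.mk w) • x₀

end Connection

/-! ### Coverings and induced bundles -/

section Induced

/-- A smooth covering `q : M' → M`. -/
structure SmoothCovering (EM : Type*) [NormedAddCommGroup EM] [NormedSpace ℝ EM]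
    (M' : Type*) [TopologicalSpace M'] [ChartedSpace EM M']
    (M : Type*) [TopologicalSpace M] [ChartedSpace EM M] where
  toFun : M' → M
  isCoveringMap : IsCoveringMap toFun
  isLocalDiffeomorph : IsLocalDiffeomorph 𝓘(ℝ, EM) 𝓘(ℝ, EM) ∞ toFun

variable {EG : Type*} [NormedAddCommGroup EG] [NormedSpace ℝ EG]
  {G : Type*} [TopologicalSpace G] [ChartedSpace EG G] [Group G]
  {EP : Type*} [NormedAddCommGroup EP] [NormedSpace ℝ EP]
  {P : Type*} [TopologicalSpace P] [ChartedSpace EP P] [MulAction G P]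
  {EM : Type*} [NormedAddCommGroup EM] [NormedSpace ℝ EM]
  {M : Type*} [TopologicalSpace M] [ChartedSpace EM M]
  {M' : Type*} [TopologicalSpace M'] [ChartedSpace EM M']

/-- The covering projection as a continuous map. -/
def SmoothCovering.toContinuousMap (q : SmoothCovering EM M' M) : C(M', M) :=
  ⟨q.toFun, q.isCoveringMap.continuous⟩

/-- The total space of the bundle induced by `q`: the fibre product of `M'` and `P` over `M`. -/
@[ext] structure InducedBundle (π : PrincipalBundle EG G EP P EM M)
    (q : SmoothCovering EM M' M) where
  /-- the bundle projection `InducedBundle → M'` -/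
  toBase : M'
  /-- the canonical map `InducedBundle → P` covering `q` -/
  toBundle : P
  comm : π.proj toBundle = q.toContinuousMap toBase

namespace InducedBundle

variable {π : PrincipalBundle EG G EP P EM M} {q : SmoothCovering EM M' M}

instance : TopologicalSpace (InducedBundle π q) :=
  TopologicalSpace.induced (fun z => (z.toBase, z.toBundle)) inferInstance

lemma isInducing : Topology.IsInducing
    (fun z : InducedBundle π q => (z.toBase, z.toBundle)) := ⟨rfl⟩

lemma continuous_toBase : Continuous (toBase : InducedBundle π q → M') :=
  continuous_fst.comp isInducing.continuous

lemma continuous_toBundle : Continuous (toBundle : InducedBundle π q → P) :=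
  continuous_snd.comp isInducing.continuous

instance : MulAction G (InducedBundle π q) where
  smul g z := ⟨z.toBase, g • z.toBundle, by rw [π.proj_smul]; exact z.comm⟩
  one_smul z := InducedBundle.ext rfl (one_smul G z.toBundle)
  mul_smul g h z := InducedBundle.ext rfl (mul_smul g h z.toBundle)

@[simp] lemma toBase_smul (g : G) (z : InducedBundle π q) : (g • z).toBase = z.toBase := rfl

@[simp] lemma toBundle_smul (g : G) (z : InducedBundle π q) :
    (g • z).toBundle = g • z.toBundle := rfl

/-- The canonical map to the given bundle is a local homeomorphism. -/
lemma exists_localHomeomorph (z : InducedBundle π q) :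
    ∃ f : OpenPartialHomeomorph (InducedBundle π q) P, z ∈ f.source ∧
      ∀ y ∈ f.source, f y = toBundle y := by
  obtain ⟨e, hz, he⟩ := q.isLocalDiffeomorph.isLocalHomeomorph z.toBase
  have hq : ∀ m, q.toContinuousMap m = e m := fun m => congrFun he m
  classical
  let f : OpenPartialHomeomorph (InducedBundle π q) P :=
    { toFun := toBundle
      invFun := fun x => if h : π.proj x ∈ e.target then
        ⟨e.symm (π.proj x), x, by rw [hq]; exact (e.right_inv h).symm⟩ else z
      source := toBase ⁻¹' e.source
      target := π.proj ⁻¹' e.target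
      map_source' := fun y hy => by
        change π.proj y.toBundle ∈ e.target
        rw [comm, hq]; exact e.map_source hy
      map_target' := fun x hx => by
        have hx' : π.proj x ∈ e.target := hx
        rw [dif_pos hx']; exact e.map_target hx'
      left_inv' := fun y hy => by
        have h' : π.proj y.toBundle ∈ e.target := by
          rw [comm, hq]; exact e.map_source hy
        rw [dif_pos h']
        refine InducedBundle.ext ?_ rfl
        change e.symm (π.proj y.toBundle) = y.toBase
        rw [comm, hq]; exact e.left_inv hy
      right_inv' := fun x hx => by
        have hx' : π.proj x ∈ e.target := hx
        rw [dif_pos hx']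
      open_source := e.open_source.preimage continuous_toBase
      open_target := e.open_target.preimage π.smooth_proj.continuous
      continuousOn_toFun := continuous_toBundle.continuousOn
      continuousOn_invFun := by
        rw [isInducing.continuousOn_iff]
        refine ContinuousOn.congr (f := fun x => (e.symm (π.proj x), x)) ?_ ?_
        · exact (e.continuousOn_symm.comp π.smooth_proj.continuous.continuousOn
            (fun x hx => hx)).prodMk continuousOn_id
        · intro x hx
          have hx' : π.proj x ∈ e.target := hx
          simp only [Function.comp, dif_pos hx'] }
  exact ⟨f, hz, fun y _ => rfl⟩

/-- The smooth structure of the induced bundle: its charts are the charts of `P`, pulled back by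
local inverses of the canonical map to `P`. -/
instance : ChartedSpace EP (InducedBundle π q) where
  atlas := {c | ∃ f : OpenPartialHomeomorph (InducedBundle π q) P,
    (∀ y ∈ f.source, f y = toBundle y) ∧ ∃ d ∈ atlas EP P, c = f.trans d}
  chartAt z := (exists_localHomeomorph z).choose.trans (chartAt EP z.toBundle)
  mem_chart_source z := by
    have h := (exists_localHomeomorph z).choose_spec
    refine ⟨h.1, ?_⟩
    change (exists_localHomeomorph z).choose z ∈ (chartAt EP z.toBundle).source
    rw [h.2 z h.1]; exact mem_chart_source EP _
  chart_mem_atlas z := ⟨_, (exists_localHomeomorph z).choose_spec.2, _, chart_mem_atlas EP _, rfl⟩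

instance [IsManifold 𝓘(ℝ, EP) ∞ P] : IsManifold 𝓘(ℝ, EP) ∞ (InducedBundle π q) := by
  refine isManifold_of_contDiffOn 𝓘(ℝ, EP) ∞ _ ?_
  rintro _ _ ⟨f, hf, d, hd, rfl⟩ ⟨f', hf', d', hd', rfl⟩
  have h := (contDiffGroupoid ∞ 𝓘(ℝ, EP)).compatible hd hd'
  rw [contDiffGroupoid, mem_groupoid_of_pregroupoid] at h
  have h1 : ContDiffOn ℝ ∞ (d.symm.trans d') (d.symm.trans d').source := by
    simpa [contDiffPregroupoid] using h.1
  have key : ∀ y ∈ ((f.trans d).symm.trans (f'.trans d')).source,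
      f' (f.symm (d.symm y)) = d.symm y := by
    intro y hy
    have h1 : d.symm y ∈ f.target := by
      simp only [mfld_simps] at hy; exact hy.1.2
    have h2 : f.symm (d.symm y) ∈ f'.source := by
      simp only [mfld_simps] at hy; exact hy.2.1
    rw [hf' _ h2, ← hf _ (f.map_target h1), f.right_inv h1]
  have h2 : ContDiffOn ℝ ∞ ((f.trans d).symm.trans (f'.trans d'))
      ((f.trans d).symm.trans (f'.trans d')).source := by
    refine (h1.mono ?_).congr ?_
    · intro y hy
      have hk := key y hy
      simp only [mfld_simps] at hy hk ⊢
      refine ⟨hy.1.1, ?_⟩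
      have := hy.2.2
      rwa [hk] at this
    · intro y hy
      have hk := key y hy
      simp only [mfld_simps] at hk ⊢
      rw [hk]
  simpa using h2

/-- The canonical map to the given bundle is a local diffeomorphism. -/
lemma isLocalDiffeomorph_toBundle [IsManifold 𝓘(ℝ, EP) ∞ P] :
    IsLocalDiffeomorph 𝓘(ℝ, EP) 𝓘(ℝ, EP) ∞ (toBundle : InducedBundle π q → P) := by
  intro z
  obtain ⟨f, hz, hf⟩ := exists_localHomeomorph z
  have h1 : ∀ d ∈ atlas EP P, f.trans d ∈ atlas EP (InducedBundle π q) :=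
    fun d hd => ⟨f, hf, d, hd, rfl⟩
  refine ⟨⟨f.toPartialEquiv, f.open_source, f.open_target, ?_, ?_⟩, hz, fun y hy => (hf y hy).symm⟩
  · intro y hy
    have hc := h1 (chartAt EP (f y)) (chart_mem_atlas EP _)
    refine ContMDiffAt.contMDiffWithinAt ?_
    have hm := contMDiffAt_of_mem_maximalAtlas (I := 𝓘(ℝ, EP)) (n := ∞)
      (IsManifold.subset_maximalAtlas hc) (x := y) ⟨hy, mem_chart_source EP (f y)⟩
    have hs := (contMDiffAt_symm_of_mem_maximalAtlas (I := 𝓘(ℝ, EP)) (n := ∞)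
      (IsManifold.chart_mem_maximalAtlas (f y)) (x := chartAt EP (f y) (f y))
      ((chartAt EP (f y)).map_source (mem_chart_source EP (f y))))
    refine (hs.comp y hm).congr_of_eventuallyEq ?_
    have : (f.trans (chartAt EP (f y))).source ∈ 𝓝 y :=
      (f.trans (chartAt EP (f y))).open_source.mem_nhds ⟨hy, mem_chart_source EP (f y)⟩
    filter_upwards [this] with u hu
    exact ((chartAt EP (f y)).left_inv hu.2).symm
  · intro x hx
    have hc := h1 (chartAt EP x) (chart_mem_atlas EP _)
    refine ContMDiffAt.contMDiffWithinAt ?_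
    have hm := contMDiffAt_of_mem_maximalAtlas (I := 𝓘(ℝ, EP)) (n := ∞)
      (IsManifold.chart_mem_maximalAtlas x) (mem_chart_source EP x)
    have ht : chartAt EP x x ∈ (f.trans (chartAt EP x)).target := by
      have hs := mem_chart_source EP x
      refine ⟨(chartAt EP x).map_source hs, ?_⟩
      change (chartAt EP x).symm (chartAt EP x x) ∈ f.target
      rwa [(chartAt EP x).left_inv hs]
    have hs := (contMDiffAt_symm_of_mem_maximalAtlas (I := 𝓘(ℝ, EP)) (n := ∞)
      (IsManifold.subset_maximalAtlas hc) ht)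
    refine (hs.comp x hm).congr_of_eventuallyEq ?_
    filter_upwards [(chartAt EP x).open_source.mem_nhds (mem_chart_source EP x)] with u hu
    change f.symm u = f.symm ((chartAt EP x).symm (chartAt EP x u))
    rw [(chartAt EP x).left_inv hu]

end InducedBundle

/-- A continuous map into the source of a local diffeomorphism is smooth if the composite is. -/
lemma contMDiffWithinAt_of_comp
    {E H X : Type*} [NormedAddCommGroup E] [NormedSpace ℝ E] [TopologicalSpace H]
    {I : ModelWithCorners ℝ E H} [TopologicalSpace X] [ChartedSpace H X]
    {F N N' : Type*} [NormedAddCommGroup F] [NormedSpace ℝ F]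
    [TopologicalSpace N] [ChartedSpace F N] [TopologicalSpace N'] [ChartedSpace F N']
    {f : N → N'} (hf : IsLocalDiffeomorph 𝓘(ℝ, F) 𝓘(ℝ, F) ∞ f) {g : X → N} {s : Set X} {x : X}
    (hg : ContinuousWithinAt g s x) (hfg : ContMDiffWithinAt I 𝓘(ℝ, F) ∞ (f ∘ g) s x) :
    ContMDiffWithinAt I 𝓘(ℝ, F) ∞ g s x := by
  obtain ⟨Φ, hx, hΦ⟩ := hf (g x)
  have h1 : ContMDiffAt 𝓘(ℝ, F) 𝓘(ℝ, F) ∞ Φ.symm ((f ∘ g) x) := by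
    refine Φ.symm.contMDiffOn.contMDiffAt (Φ.open_target.mem_nhds ?_)
    have := Φ.map_source hx
    rwa [Function.comp, hΦ hx]
  have hev : ∀ u, g u ∈ Φ.source → g u = (Φ.symm ∘ (f ∘ g)) u := fun u hu => by
    have : Φ.symm (Φ (g u)) = g u := Φ.left_inv hu
    simp only [Function.comp]
    rw [hΦ hu, this]
  refine (h1.comp_contMDiffWithinAt x hfg).congr_of_eventuallyEq ?_ (hev x hx)
  filter_upwards [hg (Φ.open_source.mem_nhds hx)] with u hu using hev u hu

section Construction

variable [IsManifold 𝓘(ℝ, EP) ∞ P]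
  (π : PrincipalBundle EG G EP P EM M) (q : SmoothCovering EM M' M)

lemma InducedBundle.smooth_toBundle :
    ContMDiff 𝓘(ℝ, EP) 𝓘(ℝ, EP) ∞ (toBundle : InducedBundle π q → P) :=
  isLocalDiffeomorph_toBundle.contMDiff

lemma InducedBundle.smooth_toBase :
    ContMDiff 𝓘(ℝ, EP) 𝓘(ℝ, EM) ∞ (toBase : InducedBundle π q → M') := by
  intro z
  refine contMDiffWithinAt_of_comp q.isLocalDiffeomorph
    continuous_toBase.continuousAt.continuousWithinAt ?_
  have : q.toFun ∘ (toBase : InducedBundle π q → M') = π.proj ∘ toBundle :=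
    funext fun y => y.comm.symm
  rw [this]
  exact (π.smooth_proj.comp (smooth_toBundle π q)) z

variable {π}

open Classical in
/-- A local trivialization of `P` over `U` induces one over `q⁻¹(U)`. -/
def InducedBundle.trivialization (z₀ : InducedBundle π q) (e : Bundle.Trivialization G π.proj) :
    Bundle.Trivialization G (toBase : InducedBundle π q → M') where
  toFun z := (z.toBase, (e z.toBundle).2)
  invFun y := if h : q.toContinuousMap y.1 ∈ e.baseSet then
    ⟨y.1, e.toOpenPartialHomeomorph.symm (q.toContinuousMap y.1, y.2), e.proj_symm_apply' h⟩ else z₀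
  source := toBase ⁻¹' (q.toContinuousMap ⁻¹' e.baseSet)
  target := (q.toContinuousMap ⁻¹' e.baseSet) ×ˢ univ
  map_source' z hz := ⟨hz, trivial⟩
  map_target' y hy := by
    have h : q.toContinuousMap y.1 ∈ e.baseSet := hy.1
    rw [dif_pos h]; exact h
  left_inv' z hz := by
    have h : q.toContinuousMap z.toBase ∈ e.baseSet := hz
    rw [dif_pos h]
    refine InducedBundle.ext rfl ?_
    change e.toOpenPartialHomeomorph.symm (q.toContinuousMap z.toBase, (e z.toBundle).2) = _
    rw [← z.comm] at h ⊢
    exact e.symm_apply_mk_proj (e.mem_source.2 h)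
  right_inv' y hy := by
    have h : q.toContinuousMap y.1 ∈ e.baseSet := hy.1
    rw [dif_pos h]
    refine Prod.ext rfl ?_
    change (e (e.toOpenPartialHomeomorph.symm (q.toContinuousMap y.1, y.2))).2 = y.2
    rw [e.apply_symm_apply' h]
  open_source := (e.open_baseSet.preimage q.toContinuousMap.continuous).preimage continuous_toBase
  open_target := (e.open_baseSet.preimage q.toContinuousMap.continuous).prod isOpen_univ
  continuousOn_toFun := by
    refine continuous_toBase.continuousOn.prodMk (continuous_snd.comp_continuousOn ?_)
    refine e.continuousOn_toFun.comp continuous_toBundle.continuousOn fun z hz => ?_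
    refine e.mem_source.2 ?_
    rw [z.comm]; exact hz
  continuousOn_invFun := by
    rw [isInducing.continuousOn_iff]
    refine ContinuousOn.congr (f := fun y =>
      (y.1, e.toOpenPartialHomeomorph.symm (q.toContinuousMap y.1, y.2))) ?_ ?_
    · refine continuousOn_fst.prodMk (e.continuousOn_invFun.comp
        ((q.toContinuousMap.continuous.comp continuous_fst).prodMk continuous_snd).continuousOn ?_)
      intro y hy
      exact e.mem_target.2 hy.1
    · intro y hy
      have h : q.toContinuousMap y.1 ∈ e.baseSet := hy.1
      simp only [Function.comp, dif_pos h]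
  baseSet := q.toContinuousMap ⁻¹' e.baseSet
  open_baseSet := e.open_baseSet.preimage q.toContinuousMap.continuous
  source_eq := rfl
  target_eq := rfl
  proj_toFun _ _ := rfl

variable {q} in
lemma InducedBundle.isPrincipalTrivialization (z₀ : InducedBundle π q)
    {e : Bundle.Trivialization G π.proj} (he : IsPrincipalTrivialization EG EP EM e) :
    IsPrincipalTrivialization EG EP EM (trivialization q z₀ e) where
  smooth := by
    refine (smooth_toBase π q).contMDiffOn.prodMk (contMDiff_snd.comp_contMDiffOn
      (he.smooth.comp (smooth_toBundle π q).contMDiffOn ?_))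
    intro z hz
    refine e.mem_source.2 ?_
    rw [z.comm]; exact hz
  smooth_symm := by
    classical
    intro y hy
    refine contMDiffWithinAt_of_comp isLocalDiffeomorph_toBundle
      ((trivialization q z₀ e).continuousOn_invFun y hy) ?_
    have h1 : ContMDiffOn (𝓘(ℝ, EM).prod 𝓘(ℝ, EG)) 𝓘(ℝ, EP) ∞
        (fun y : M' × G => e.toOpenPartialHomeomorph.symm (q.toContinuousMap y.1, y.2))
        (trivialization q z₀ e).target := by
      refine he.smooth_symm.comp (((q.isLocalDiffeomorph.contMDiff.comp contMDiff_fst).prodMk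
        contMDiff_snd).contMDiffOn) ?_
      intro y hy
      exact e.mem_target.2 hy.1
    refine (h1 y hy).congr ?_ ?_
    · intro u hu
      have h : q.toContinuousMap u.1 ∈ e.baseSet := hu.1
      change (dite _ _ _ : InducedBundle π q).toBundle = _
      rw [dif_pos h]
    · have h : q.toContinuousMap y.1 ∈ e.baseSet := hy.1
      change (dite _ _ _ : InducedBundle π q).toBundle = _
      rw [dif_pos h]
  map_smul g z hz := by
    refine he.map_smul g z.toBundle (e.mem_source.2 ?_)
    rw [z.comm]; exact hz

variable (π) in
/-- The induced principal bundle over `M'`. -/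
def PrincipalBundle.induced : PrincipalBundle EG G EP (InducedBundle π q) EM M' where
  proj := InducedBundle.toBase
  smooth_smul := by
    intro y
    have h1 : ContMDiff (𝓘(ℝ, EG).prod 𝓘(ℝ, EP)) 𝓘(ℝ, EP) ∞
        (fun z : G × InducedBundle π q => z.1 • z.2.toBundle) :=
      π.smooth_smul.comp
        (contMDiff_fst.prodMk ((InducedBundle.smooth_toBundle π q).comp contMDiff_snd))
    refine contMDiffWithinAt_of_comp InducedBundle.isLocalDiffeomorph_toBundle ?_ (h1 y)
    refine Continuous.continuousWithinAt (InducedBundle.isInducing.continuous_iff.2 ?_)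
    exact (InducedBundle.continuous_toBase.comp continuous_snd).prodMk h1.continuous
  smooth_proj := InducedBundle.smooth_toBase π q
  proj_smul _ _ := rfl
  locally_trivial m := by
    obtain ⟨e, hm, he⟩ := π.locally_trivial (q.toContinuousMap m)
    let z₀ : InducedBundle π q :=
      ⟨m, e.toOpenPartialHomeomorph.symm (q.toContinuousMap m, 1), e.proj_symm_apply' hm⟩
    exact ⟨InducedBundle.trivialization q z₀ e, hm, InducedBundle.isPrincipalTrivialization z₀ he⟩

/-- The connection induced by `q`: the pull-back of the connection form to the induced bundle. -/
def ConnectionForm.induced (θ : ConnectionForm π) : ConnectionForm (π.induced q) where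
  form z := (θ.form z.toBundle).comp
    (mfderiv 𝓘(ℝ, EP) 𝓘(ℝ, EP) (InducedBundle.toBundle : InducedBundle π q → P) z)
  smooth := θ.smooth.comp
    ((InducedBundle.smooth_toBundle π q).contMDiff_tangentMap (m := ∞) (by simp))
  fundamental z A := by
    have h := θ.fundamental z.toBundle A
    have hs : MDifferentiableAt 𝓘(ℝ, EG) 𝓘(ℝ, EP) (fun g : G => g • z) 1 :=
      (((π.induced q).smooth_smul.comp
        (contMDiff_id.prodMk contMDiff_const)) 1).mdifferentiableAt (by simp)
    have hc := mfderiv_comp (1 : G) ((InducedBundle.smooth_toBundle π q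
      ((1 : G) • z)).mdifferentiableAt (by simp)) hs
    refine Eq.trans ?_ h
    exact congrArg (θ.form ((1 : G) • z.toBundle)) (DFunLike.congr_fun hc A).symm
  equivariant g z v := by
    have h := θ.equivariant g z.toBundle
      (mfderiv 𝓘(ℝ, EP) 𝓘(ℝ, EP) (InducedBundle.toBundle : InducedBundle π q → P) z v)
    have hs : MDifferentiableAt 𝓘(ℝ, EP) 𝓘(ℝ, EP) (fun y : InducedBundle π q => g • y) z :=
      (((π.induced q).smooth_smul.comp
        (contMDiff_const.prodMk contMDiff_id)) z).mdifferentiableAt (by simp)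
    have hs' : MDifferentiableAt 𝓘(ℝ, EP) 𝓘(ℝ, EP) (fun y : P => g • y) z.toBundle :=
      ((π.smooth_smul.comp
        (contMDiff_const.prodMk contMDiff_id)) z.toBundle).mdifferentiableAt (by simp)
    have hd : ∀ y : InducedBundle π q, MDifferentiableAt 𝓘(ℝ, EP) 𝓘(ℝ, EP)
        (InducedBundle.toBundle : InducedBundle π q → P) y := fun y =>
      (InducedBundle.smooth_toBundle π q y).mdifferentiableAt (by simp)
    have hc := mfderiv_comp z (hd (g • z)) hs
    have hc' := mfderiv_comp z hs' (hd z)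
    refine Eq.trans ?_ h
    exact congrArg (θ.form (g • z.toBundle))
      ((DFunLike.congr_fun hc v).symm.trans (DFunLike.congr_fun hc' v))

end Construction

end Induced

end FlatHolonomy

end

/-!
The proof replaces the parallel transport of a flat connection by path lifting in a covering space.

Let `LeafSpace θ` be the total space `P` with the leaf topology, in which the horizontal slices
`{x ∈ p⁻¹(U) | (e x).2 = a}` of the flat trivializations `e` are open. Two flat trivializations
differ by a function `U ∩ U' → G` with vanishing derivative (`isOpen_transition`), so the slices fit
together, and `LeafSpace θ → M` is a covering on whose fibres the discrete group `G` acts simply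
transitively (`LeafSpace.isQuotientCoveringMap`). Horizontal lifts of a piecewise smooth path `w`
are the same as continuous lifts of `w` to `LeafSpace θ`: a path in `P` whose velocity is horizontal
off a finite set stays in one slice locally, by the mean value theorem
(`IsHorizontalLift.continuous_leafSpace`), and conversely a continuous path in the leaf topology is
locally the image of `w` under a smooth horizontal section
(`isHorizontalLift_of_continuous_leafSpace`). Existence and uniqueness of lifts, their invariance
under homotopy and the homomorphism property therefore come from the monodromy of coverings
(`isHolonomy_holonomy`).

The defining property of the holonomy only speaks of piecewise smooth loops; it determines the
homomorphism because `G` acts freely and every path is homotopic, with fixed end points, to a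
piecewise smooth one (`exists_homotopic_isPiecewiseSmooth`).

The flat trivializations of `θ` induce flat trivializations of the induced bundle
(`IsFlatTrivialization.induced`). The canonical map of the induced bundle to `P` carries horizontal
lifts of `w` to horizontal lifts of `q ∘ w` (`IsHorizontalLift.map_toBundle`) and commutes with the
action of `G`; comparing end points gives `h' = h ∘ q_#`.
-/

namespace FlatHolonomy

/-! ### Maps with vanishing derivative -/

section LocallyConstant

variable {E F : Type*} [NormedAddCommGroup E] [NormedSpace ℝ E]
  [NormedAddCommGroup F] [NormedSpace ℝ F]
  {X : Type*} [TopologicalSpace X] [ChartedSpace E X] [IsManifold 𝓘(ℝ, E) ∞ X]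
  {Y : Type*} [TopologicalSpace Y] [ChartedSpace F Y] [IsManifold 𝓘(ℝ, F) ∞ Y]

/-- A map between manifolds with zero derivative on an open set is locally constant there. -/
lemma isOpen_fiber_of_mfderiv_eq_zero {f : X → Y} {W : Set X} (hW : IsOpen W)
    (hf : ∀ x ∈ W, MDifferentiableAt 𝓘(ℝ, E) 𝓘(ℝ, F) f x)
    (hf' : ∀ x ∈ W, mfderiv 𝓘(ℝ, E) 𝓘(ℝ, F) f x = 0) (c : Y) :
    IsOpen {x ∈ W | f x = c} := by
  rw [isOpen_iff_mem_nhds]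
  rintro x₀ ⟨hx₀, rfl⟩
  set φ := chartAt E x₀
  set ψ := chartAt F (f x₀)
  have hxφ : x₀ ∈ φ.source := mem_chart_source E x₀
  have hW' : W ∩ f ⁻¹' ψ.source ∈ 𝓝 x₀ := Filter.inter_mem (hW.mem_nhds hx₀)
    ((hf x₀ hx₀).continuousAt (ψ.open_source.mem_nhds (mem_chart_source F _)))
  have h1 : φ.target ∩ φ.symm ⁻¹' (W ∩ f ⁻¹' ψ.source) ∈ 𝓝 (φ x₀) := by
    refine Filter.inter_mem (φ.open_target.mem_nhds (φ.map_source hxφ)) ?_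
    refine (φ.continuousAt_symm (φ.map_source hxφ)) ?_
    rwa [φ.left_inv hxφ]
  obtain ⟨ε, hε, hB⟩ := Metric.mem_nhds_iff.1 h1
  have key : ∀ y ∈ Metric.ball (φ x₀) ε, HasFDerivAt (ψ ∘ f ∘ φ.symm) (0 : E →L[ℝ] F) y := by
    intro y hy
    obtain ⟨hy1, hy2, hy3⟩ := hB hy
    have d1 : MDifferentiableAt 𝓘(ℝ, E) 𝓘(ℝ, E) φ.symm y :=
      mdifferentiableAt_atlas_symm (chart_mem_atlas E x₀) hy1
    have d2 := (hf _ hy2).hasMFDerivAt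
    have d3 : MDifferentiableAt 𝓘(ℝ, F) 𝓘(ℝ, F) ψ (f (φ.symm y)) :=
      mdifferentiableAt_atlas (chart_mem_atlas F (f x₀)) hy3
    rw [hf' _ hy2] at d2
    have := d3.hasMFDerivAt.comp y (d2.comp y d1.hasMFDerivAt)
    rw [ContinuousLinearMap.zero_comp, ContinuousLinearMap.comp_zero] at this
    exact hasMFDerivAt_iff_hasFDerivAt.1 this
  have hconst : ∀ y ∈ Metric.ball (φ x₀) ε, ψ (f (φ.symm y)) = ψ (f (φ.symm (φ x₀))) := by
    intro y hy
    refine Metric.isOpen_ball.is_const_of_fderiv_eq_zero (𝕜 := ℝ) (f := ψ ∘ f ∘ φ.symm)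
      (convex_ball _ _).isPreconnected ?_ ?_ hy (Metric.mem_ball_self hε)
    · exact fun z hz => (key z hz).differentiableAt.differentiableWithinAt
    · exact fun z hz => (key z hz).fderiv
  have h2 : φ.source ∩ φ ⁻¹' Metric.ball (φ x₀) ε ∈ 𝓝 x₀ :=
    Filter.inter_mem (φ.open_source.mem_nhds hxφ)
      (φ.continuousAt hxφ (Metric.ball_mem_nhds _ hε))
  filter_upwards [h2] with x ⟨hx1, hx2⟩
  have h3 := hconst _ hx2
  obtain ⟨-, hy2, hy3⟩ := hB hx2
  rw [φ.left_inv hxφ] at h3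
  simp only [mem_preimage] at hy3
  rw [φ.left_inv hx1] at h3 hy2 hy3
  exact ⟨hy2, ψ.injOn hy3 (mem_chart_source F _) h3⟩

/-- A continuous curve in a manifold is locally constant if its derivative vanishes off a countable
set. The end points of `[a, b]` need not satisfy the condition on the derivative. -/
lemma eventually_eq_of_mfderiv_eq_zero_off_countable [CompleteSpace F] {f : ℝ → Y} {t : ℝ}
    {a b : ℝ} (ht : t ∈ Icc a b) {S : Set ℝ} (hS : S.Countable)
    (hc : ∀ᶠ s in 𝓝 t, ContinuousAt f s)
    (hd : ∀ᶠ s in 𝓝 t, s ∈ Ioo a b \ S → HasMFDerivAt 𝓘(ℝ, ℝ) 𝓘(ℝ, F) f s 0) :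
    ∀ᶠ s in 𝓝 t, s ∈ Icc a b → f s = f t := by
  set ψ := chartAt F (f t)
  have hs : ∀ᶠ s in 𝓝 t, f s ∈ ψ.source :=
    hc.self_of_nhds (ψ.open_source.mem_nhds (mem_chart_source F _))
  obtain ⟨ε, hε, hB⟩ := Metric.mem_nhds_iff.1 (hc.and (hd.and hs))
  filter_upwards [Metric.ball_mem_nhds t hε] with s hs hsab
  have hsub : uIcc t s ⊆ Metric.ball t ε := by
    rw [Real.ball_eq_Ioo] at hs ⊢
    exact ordConnected_Ioo.uIcc_subset (by constructor <;> linarith) hs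
  have hcd : ∀ u ∈ uIcc t s, MDifferentiableAt 𝓘(ℝ, F) 𝓘(ℝ, F) ψ (f u) := fun u hu =>
    mdifferentiableAt_atlas (chart_mem_atlas F (f t)) (hB (hsub hu)).2.2
  have h := MeasureTheory.integral_eq_of_hasDerivAt_off_countable (ψ ∘ f) (fun _ => (0 : F))
    (a := t) (b := s) hS ?_ ?_ (by simp)
  · simp only [intervalIntegral.integral_zero, Function.comp] at h
    exact ψ.injOn (hB hs).2.2 (mem_chart_source F _) (sub_eq_zero.1 h.symm)
  · intro u hu
    exact ((hcd u hu).continuousAt.comp (hB (hsub hu)).1).continuousWithinAt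
  · rintro u ⟨hu, huS⟩
    have hu' : u ∈ uIcc t s := Ioo_subset_Icc_self hu
    have hab : u ∈ Ioo a b := ⟨(le_min ht.1 hsab.1).trans_lt hu.1,
      hu.2.trans_le (max_le ht.2 hsab.2)⟩
    have := (hcd u hu').hasMFDerivAt.comp u ((hB (hsub hu')).2.1 ⟨hab, huS⟩)
    rw [ContinuousLinearMap.comp_zero] at this
    have h : HasFDerivAt (ψ ∘ f) (0 : ℝ →L[ℝ] F) u := hasMFDerivAt_iff_hasFDerivAt.1 this
    exact h.hasDerivAt

end LocallyConstant

/-! ### Piecewise smooth paths -/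

section PiecewiseSmooth

variable {E : Type*} [NormedAddCommGroup E] [NormedSpace ℝ E]
  {X : Type*} [TopologicalSpace X] [ChartedSpace E X] {x y z : X}

lemma IsPiecewiseSmooth.exists_countable {γ : Path x y} (hγ : IsPiecewiseSmooth E γ) :
    ∃ S : Set ℝ, S.Countable ∧
      ∀ s ∈ Ioo (0 : ℝ) 1 \ S, MDifferentiableAt 𝓘(ℝ, ℝ) 𝓘(ℝ, E) γ.extend s := by
  obtain ⟨n, t, ht, h0, h1, hs⟩ := hγ
  refine ⟨range t, countable_range t, ?_⟩
  rintro s ⟨⟨hs0, hs1⟩, hS⟩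
  have hex : ∃ i, s < t i := ⟨n, by rwa [h1]⟩
  classical
  obtain ⟨i, hi⟩ : ∃ i, Nat.find hex = i + 1 :=
    Nat.exists_eq_succ_of_ne_zero fun h => by
      have := Nat.find_spec hex
      rw [h, h0] at this; linarith
  have hlt : s < t (i + 1) := hi ▸ Nat.find_spec hex
  have hge : t i < s := lt_of_le_of_ne (not_lt.1 (Nat.find_min hex (by omega)))
    fun h => hS ⟨i, h⟩
  have hin : i < n := by
    have := Nat.find_min' hex (m := n) (by rwa [h1]); omega
  exact ((hs i hin).contMDiffAt (Icc_mem_nhds hge hlt)).mdifferentiableAt (by simp)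

lemma IsPiecewiseSmooth.of_contMDiffOn {γ : Path x y}
    (hγ : ContMDiffOn 𝓘(ℝ, ℝ) 𝓘(ℝ, E) ∞ γ.extend (Icc 0 1)) : IsPiecewiseSmooth E γ := by
  refine ⟨1, fun i => i, Nat.mono_cast, by simp, by simp, fun i hi => ?_⟩
  obtain rfl : i = 0 := by omega
  simpa using hγ

lemma IsPiecewiseSmooth.map {E E' X X' : Type*} [NormedAddCommGroup E] [NormedSpace ℝ E]
    [NormedAddCommGroup E'] [NormedSpace ℝ E'] [TopologicalSpace X] [ChartedSpace E X]
    [TopologicalSpace X'] [ChartedSpace E' X'] {x y : X} {γ : Path x y}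
    (hγ : IsPiecewiseSmooth E γ) {f : X → X'} (hf : ContMDiff 𝓘(ℝ, E) 𝓘(ℝ, E') ∞ f) :
    IsPiecewiseSmooth E' (γ.map hf.continuous) := by
  obtain ⟨n, t, ht, h0, h1, hs⟩ := hγ
  exact ⟨n, t, ht, h0, h1, fun i hi => hf.comp_contMDiffOn (hs i hi)⟩

lemma IsPiecewiseSmooth.trans {γ : Path x y} {γ' : Path y z} (hγ : IsPiecewiseSmooth E γ)
    (hγ' : IsPiecewiseSmooth E γ') : IsPiecewiseSmooth E (γ.trans γ') := by
  obtain ⟨n, t, ht, ht0, ht1, hts⟩ := hγ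
  obtain ⟨k, s, hs, hs0, hs1, hss⟩ := hγ'
  -- The subdivision is `t i / 2` up to `i = n`, and `(1 + s (i - n)) / 2` afterwards; both formulas
  -- give `1 / 2` at `i = n`.
  have hr : ∀ i ≤ n, (if i < n then t i / 2 else (1 + s (i - n)) / 2) = t i / 2 := by
    intro i hi
    split_ifs with h
    · rfl
    · obtain rfl : i = n := by omega
      simp [hs0, ht1]
  have hr' : ∀ i, n ≤ i → (if i < n then t i / 2 else (1 + s (i - n)) / 2)
      = (1 + s (i - n)) / 2 := fun i hi => if_neg (by omega)
  refine ⟨n + k, fun i => if i < n then t i / 2 else (1 + s (i - n)) / 2, ?_, ?_, ?_, ?_⟩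
  · refine monotone_nat_of_le_succ fun i => ?_
    rcases lt_or_ge i n with h | h
    · rw [hr i h.le, hr (i + 1) h]
      linarith [ht (Nat.le_succ i)]
    · rw [hr' i h, hr' (i + 1) (by omega)]
      linarith [hs (show i - n ≤ i + 1 - n by omega)]
  · exact (hr 0 (Nat.zero_le _)).trans (by rw [ht0, zero_div])
  · refine (hr' _ (Nat.le_add_right n k)).trans ?_
    rw [Nat.add_sub_cancel_left, hs1]; norm_num
  · intro i hi
    beta_reduce
    rcases lt_or_ge i n with h | h
    · have h0 : 0 ≤ t i := ht0 ▸ ht (Nat.zero_le i)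
      have h1 : t (i + 1) ≤ 1 := ht1 ▸ ht (show i + 1 ≤ n from h)
      rw [hr i h.le, hr (i + 1) h]
      have hd : ContMDiff 𝓘(ℝ, ℝ) 𝓘(ℝ, ℝ) ∞ (fun u : ℝ => 2 * u) :=
        (contDiff_const.mul contDiff_id).contMDiff
      refine ((hts i h).comp hd.contMDiffOn (s := Icc (t i / 2) (t (i + 1) / 2)) ?_).congr ?_
      · rintro u ⟨hu1, hu2⟩
        constructor <;> linarith
      · rintro u ⟨hu1, hu2⟩
        have hu : u ∈ Icc (0 : ℝ) 1 := by constructor <;> linarith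
        rw [Path.extend_apply _ hu, Path.trans_apply, dif_pos (by simp; linarith)]
        simp only [Function.comp]
        rw [Path.extend_apply]
    · have h0 : 0 ≤ s (i - n) := hs0 ▸ hs (Nat.zero_le _)
      have h1 : s (i - n + 1) ≤ 1 := hs1 ▸ hs (show i - n + 1 ≤ k by omega)
      have h2 : i + 1 - n = i - n + 1 := by omega
      rw [hr' i h, hr' (i + 1) (by omega), h2]
      have hd : ContMDiff 𝓘(ℝ, ℝ) 𝓘(ℝ, ℝ) ∞ (fun u : ℝ => 2 * u - 1) :=
        ((contDiff_const.mul contDiff_id).sub contDiff_const).contMDiff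
      refine ((hss (i - n) (by omega)).comp hd.contMDiffOn
        (s := Icc ((1 + s (i - n)) / 2) ((1 + s (i - n + 1)) / 2)) ?_).congr ?_
      · rintro u ⟨hu1, hu2⟩
        constructor <;> linarith
      · rintro u ⟨hu1, hu2⟩
        have hu : u ∈ Icc (0 : ℝ) 1 := by constructor <;> linarith
        rw [Path.extend_apply _ hu, Path.trans_apply]
        simp only [Function.comp]
        split_ifs with h3
        · obtain rfl : u = 1 / 2 := le_antisymm h3 (by linarith)
          simp
        · rw [Path.extend_apply]

variable [IsManifold 𝓘(ℝ, E) ∞ X]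

/-- Paths that stay in a convex chart domain are homotopic to the segment between their end points
in that chart. -/
lemma exists_nhds_forall_homotopic_isPiecewiseSmooth (m : X) :
    ∃ U ∈ 𝓝 m, ∀ (x y : X) (c : Path x y), (∀ t, c t ∈ U) →
      ∃ c' : Path x y, IsPiecewiseSmooth E c' ∧ c.Homotopic c' := by
  set φ := chartAt E m
  have hm : m ∈ φ.source := mem_chart_source E m
  obtain ⟨ε, hε, hB⟩ := Metric.mem_nhds_iff.1 (φ.open_target.mem_nhds (φ.map_source hm))
  refine ⟨φ.source ∩ φ ⁻¹' Metric.ball (φ m) ε, Filter.inter_mem (φ.open_source.mem_nhds hm)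
      (φ.continuousAt hm (Metric.ball_mem_nhds _ hε)), fun x y c hc => ?_⟩
  have hconv := convex_ball (φ m) ε
  have hx : φ x ∈ Metric.ball (φ m) ε := by simpa using (hc 0).2
  have hy : φ y ∈ Metric.ball (φ m) ε := by simpa using (hc 1).2
  have hxs : x ∈ φ.source := by simpa using (hc 0).1
  have hys : y ∈ φ.source := by simpa using (hc 1).1
  have hL : ∀ t ∈ Icc (0 : ℝ) 1, AffineMap.lineMap (φ x) (φ y) t ∈ Metric.ball (φ m) ε :=
    fun t ht => hconv.lineMap_mem hx hy ht
  have hφc : Continuous fun t => φ (c t) :=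
    φ.continuousOn.comp_continuous c.continuous fun t => (hc t).1
  have hH : ∀ p : unitInterval × unitInterval,
      AffineMap.lineMap (φ (c p.2)) (AffineMap.lineMap (φ x) (φ y) (p.2 : ℝ)) (p.1 : ℝ)
        ∈ Metric.ball (φ m) ε := fun p =>
    hconv.lineMap_mem (hc p.2).2 (hL p.2 p.2.2) p.1.2
  let c' : Path x y :=
    { toFun := fun t => φ.symm (AffineMap.lineMap (φ x) (φ y) (t : ℝ))
      continuous_toFun := φ.continuousOn_symm.comp_continuous
        (AffineMap.lineMap_continuous.comp continuous_subtype_val) fun t => hB (hL t t.2)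
      source' := by simp [φ.left_inv hxs]
      target' := by simp [φ.left_inv hys] }
  refine ⟨c', .of_contMDiffOn ?_, ⟨⟨⟨⟨fun p => φ.symm (AffineMap.lineMap (φ (c p.2))
    (AffineMap.lineMap (φ x) (φ y) (p.2 : ℝ)) (p.1 : ℝ)), ?_⟩, ?_, ?_⟩, ?_⟩⟩⟩
  · have hs : ContMDiff 𝓘(ℝ, ℝ) 𝓘(ℝ, E) ∞ (AffineMap.lineMap (φ x) (φ y) : ℝ → E) := by
      rw [show (AffineMap.lineMap (φ x) (φ y) : ℝ → E) = fun t => t • (φ y - φ x) + φ x from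
        funext fun t => AffineMap.lineMap_apply_module' _ _ _]
      exact ((contDiff_id.smul contDiff_const).add contDiff_const).contMDiff
    refine (((contMDiffOn_chart_symm (I := 𝓘(ℝ, E)) (n := ∞) (x := m)).comp hs.contMDiffOn
      (s := Icc 0 1)) fun t ht => hB (hL t ht)).congr fun t ht => ?_
    rw [Path.extend_apply _ ht]
    rfl
  · refine φ.continuousOn_symm.comp_continuous ?_ fun p => hB (hH p)
    have hφc' : Continuous fun p : unitInterval × unitInterval => φ (c p.2) :=
      hφc.comp continuous_snd
    have hl : Continuous fun p : unitInterval × unitInterval =>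
        AffineMap.lineMap (φ x) (φ y) (p.2 : ℝ) :=
      AffineMap.lineMap_continuous.comp (continuous_subtype_val.comp continuous_snd)
    simp only [AffineMap.lineMap_apply_module'] at hl ⊢
    exact ((continuous_subtype_val.comp continuous_fst).smul (hl.sub hφc')).add hφc'
  · intro t
    simp [φ.left_inv (hc t).1]
  · intro t
    simp [c']
  · rintro t s (rfl | rfl)
    · simp [φ.left_inv hxs]
    · simp [φ.left_inv hys]

lemma exists_homotopic_isPiecewiseSmooth (w : Path x y) :
    ∃ w' : Path x y, IsPiecewiseSmooth E w' ∧ w.Homotopic w' := by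
  -- `p t` says that `w` restricted to `[0, t]` has a piecewise smooth representative. Its truth value
  -- is locally constant in `t`, since short pieces of `w` stay in a convex chart domain.
  let p : unitInterval → Prop := fun t =>
    ∃ w' : Path (w 0) (w t), IsPiecewiseSmooth E w' ∧ (w.subpath 0 t).Homotopic w'
  have hconst : IsLocallyConstant p := by
    rw [IsLocallyConstant.iff_eventually_eq]
    intro t
    obtain ⟨U, hU, hUc⟩ := exists_nhds_forall_homotopic_isPiecewiseSmooth (E := E) (w t)
    obtain ⟨a, b, hab, hJ, hJU⟩ :=
      exists_Icc_mem_subset_of_mem_nhds (w.continuous.continuousAt (x := t) hU)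
    have step : ∀ s ∈ Icc a b, ∀ s' ∈ Icc a b, p s → p s' := by
      rintro s hs s' hs' ⟨w', hw', hh⟩
      obtain ⟨c, hc, hch⟩ := hUc _ _ (w.subpath s s') fun u => by
        have : w.subpath s s' u ∈ range (w.subpath s s') := mem_range_self u
        rw [Path.range_subpath] at this
        obtain ⟨r, hr, h⟩ := this
        rw [← h]
        exact hJU (ordConnected_Icc.uIcc_subset hs hs' hr)
      exact ⟨w'.trans c, hw'.trans hc,
        (Path.Homotopic.symm ⟨Path.Homotopy.subpathTransSubpath w 0 s s'⟩).trans (hh.hcomp hch)⟩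
    filter_upwards [hJ] with s hs
    exact propext ⟨step s hs t hab, step t hab s hs⟩
  have h0 : p 0 := by
    refine ⟨Path.refl _, .of_contMDiffOn ?_, by rw [Path.subpath_self]⟩
    rw [Path.refl_extend]
    exact contMDiffOn_const
  obtain ⟨w', hw', hh⟩ : p 1 := by
    rw [hconst.apply_eq_of_preconnectedSpace 1 0]; exact h0
  refine ⟨w'.cast w.source.symm w.target.symm, hw', ?_⟩
  rw [Path.subpath_zero_one] at hh
  exact hh.pathCast w.source.symm w.target.symm

end PiecewiseSmooth

/-! ### Principal trivializations and the action on the fibres -/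

section Leaf

variable {EG : Type*} [NormedAddCommGroup EG] [NormedSpace ℝ EG]
  {G : Type*} [TopologicalSpace G] [ChartedSpace EG G] [Group G]
  {EP : Type*} [NormedAddCommGroup EP] [NormedSpace ℝ EP]
  {P : Type*} [TopologicalSpace P] [ChartedSpace EP P] [MulAction G P]
  {EM : Type*} [NormedAddCommGroup EM] [NormedSpace ℝ EM]
  {M : Type*} [TopologicalSpace M] [ChartedSpace EM M]
  {π : PrincipalBundle EG G EP P EM M} {e e' : Bundle.Trivialization G π.proj}

lemma symm_mem_source {m : M} (hm : m ∈ e.baseSet) (hm' : m ∈ e'.baseSet) (a : G) :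
    e'.toOpenPartialHomeomorph.symm (m, a) ∈ e.source := by
  rw [e.mem_source, e'.proj_symm_apply' hm']
  exact hm

namespace IsPrincipalTrivialization

lemma mdifferentiableAt_snd (he : IsPrincipalTrivialization EG EP EM e)
    {x : P} (hx : x ∈ e.source) :
    MDifferentiableAt 𝓘(ℝ, EP) 𝓘(ℝ, EG) (fun y : P => (e y).2) x :=
  ((contMDiff_snd.comp_contMDiffOn he.smooth).contMDiffAt
    (e.open_source.mem_nhds hx)).mdifferentiableAt (by simp)

lemma contMDiffOn_slice (he : IsPrincipalTrivialization EG EP EM e)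
    (a : G) : ContMDiffOn 𝓘(ℝ, EM) 𝓘(ℝ, EP) ∞
      (fun m => e.toOpenPartialHomeomorph.symm (m, a)) e.baseSet :=
  he.smooth_symm.comp (contMDiff_id.prodMk contMDiff_const).contMDiffOn
    fun _ hm => e.mem_target.2 hm

lemma smul_symm_apply (he : IsPrincipalTrivialization EG EP EM e) {m : M} (hm : m ∈ e.baseSet)
    (g a : G) : g • e.toOpenPartialHomeomorph.symm (m, a)
      = e.toOpenPartialHomeomorph.symm (m, g * a) := by
  have h1 : π.proj (g • e.toOpenPartialHomeomorph.symm (m, a)) = m := by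
    rw [π.proj_smul, e.proj_symm_apply' hm]
  rw [← e.symm_apply_mk_proj (x := g • _) (by rw [e.mem_source, h1]; exact hm), h1,
    he.map_smul g _ (symm_mem_source hm hm a), e.apply_symm_apply' hm]

end IsPrincipalTrivialization

namespace PrincipalBundle

lemma smul_left_injective (π : PrincipalBundle EG G EP P EM M) (x : P) :
    Function.Injective fun g : G => g • x := by
  intro g h hgh
  obtain ⟨e, hm, he⟩ := π.locally_trivial (π.proj x)
  have hx : x ∈ e.source := e.mem_source.2 hm
  have h1 := congrArg (fun y => (e y).2) hgh
  simp only [he.map_smul _ _ hx] at h1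
  exact mul_right_cancel h1

lemma exists_smul_eq (π : PrincipalBundle EG G EP P EM M) {x y : P} (h : π.proj x = π.proj y) :
    ∃ g : G, g • y = x := by
  obtain ⟨e, hm, he⟩ := π.locally_trivial (π.proj x)
  have hx : x ∈ e.source := e.mem_source.2 hm
  have hy : y ∈ e.source := e.mem_source.2 (h ▸ hm)
  have hs : ((e x).2 * (e y).2⁻¹) • y ∈ e.source := by
    rwa [e.mem_source, π.proj_smul, ← h]
  refine ⟨(e x).2 * (e y).2⁻¹, e.injOn hs hx (Prod.ext ?_ ?_)⟩
  · exact (e.coe_fst hs).trans ((π.proj_smul _ _).trans (h.symm.trans (e.coe_fst hx).symm))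
  · exact (he.map_smul _ _ hy).trans (inv_mul_cancel_right _ _)

end PrincipalBundle

variable [IsManifold 𝓘(ℝ, EP) ∞ P] {θ : ConnectionForm π}

/-! ### Flat trivializations -/

/-- A flat trivialization: a principal trivialization that carries the horizontal subspaces to the
tangent spaces of the slices `U × {a}`. -/
structure ConnectionForm.IsFlatTrivialization (θ : ConnectionForm π)
    (e : Bundle.Trivialization G π.proj) : Prop extends IsPrincipalTrivialization EG EP EM e where
  form_eq_zero_iff : ∀ x ∈ e.source, ∀ v : TangentSpace 𝓘(ℝ, EP) x,
      θ.form x v = 0 ↔ mfderiv 𝓘(ℝ, EP) 𝓘(ℝ, EG) (fun y : P => (e y).2) x v = 0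

lemma ConnectionForm.IsFlat.exists_isFlatTrivialization (hθ : θ.IsFlat) (m : M) :
    ∃ e : Bundle.Trivialization G π.proj, m ∈ e.baseSet ∧ θ.IsFlatTrivialization e := by
  obtain ⟨e, hm, he, h⟩ := hθ m
  exact ⟨e, hm, he, h⟩

namespace ConnectionForm.IsFlatTrivialization

/-- The transition function between two flat trivializations is locally constant on the base: the
section `m ↦ e'⁻¹(m, a)` is horizontal, so its second component in `e` has zero derivative. -/
lemma isOpen_transition [IsManifold 𝓘(ℝ, EG) ∞ G] [IsManifold 𝓘(ℝ, EM) ∞ M]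
    (he : θ.IsFlatTrivialization e) (he' : θ.IsFlatTrivialization e')
    (a c : G) : IsOpen {m ∈ e.baseSet ∩ e'.baseSet |
      (e (e'.toOpenPartialHomeomorph.symm (m, a))).2 = c} := by
  have hd1 : ∀ m ∈ e'.baseSet, MDifferentiableAt 𝓘(ℝ, EM) 𝓘(ℝ, EP)
      (fun m => e'.toOpenPartialHomeomorph.symm (m, a)) m := fun m hm =>
    ((he'.contMDiffOn_slice a).contMDiffAt (e'.open_baseSet.mem_nhds hm)).mdifferentiableAt
      (by simp)
  refine isOpen_fiber_of_mfderiv_eq_zero (E := EM) (F := EG) (W := e.baseSet ∩ e'.baseSet)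
    (f := fun m => (e (e'.toOpenPartialHomeomorph.symm (m, a))).2)
    (e.open_baseSet.inter e'.open_baseSet) (fun m hm => ?_) (fun m hm => ?_) c
  · exact MDifferentiableAt.comp (g := fun y : P => (e y).2) m
      (he.mdifferentiableAt_snd (symm_mem_source hm.1 hm.2 a)) (hd1 m hm.2)
  · have hs := symm_mem_source (e := e) hm.1 hm.2 a
    have hs' := symm_mem_source (e := e') hm.2 hm.2 a
    have h1 := mfderiv_comp m (he.mdifferentiableAt_snd hs) (hd1 m hm.2)
    have h2 := mfderiv_comp m (he'.mdifferentiableAt_snd hs') (hd1 m hm.2)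
    have h3 : mfderiv 𝓘(ℝ, EM) 𝓘(ℝ, EG)
        ((fun y => (e' y).2) ∘ fun m => e'.toOpenPartialHomeomorph.symm (m, a)) m = 0 := by
      refine (HasMFDerivAt.congr_of_eventuallyEq (hasMFDerivAt_const a m) ?_).mfderiv
      filter_upwards [e'.open_baseSet.mem_nhds hm.2] with u hu
      simp only [Function.comp]
      rw [e'.apply_symm_apply' hu]
    refine h1.trans (ContinuousLinearMap.ext fun v => ?_)
    refine (he.form_eq_zero_iff _ hs _).1 ((he'.form_eq_zero_iff _ hs' _).2 ?_)
    exact (DFunLike.congr_fun (h2.symm.trans h3) v)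

/-- A curve is horizontal at a time iff its component along the fibre in a flat trivialization has
zero derivative there. -/
lemma form_eq_zero_iff_path (he : θ.IsFlatTrivialization e) {γ : ℝ → P} {s : ℝ}
    (hγ : MDifferentiableAt 𝓘(ℝ, ℝ) 𝓘(ℝ, EP) γ s) (hs : γ s ∈ e.source) :
    θ.form (γ s) (mfderiv 𝓘(ℝ, ℝ) 𝓘(ℝ, EP) γ s (1 : ℝ)) = 0 ↔
      HasMFDerivAt 𝓘(ℝ, ℝ) 𝓘(ℝ, EG) (fun u => (e (γ u)).2) s 0 := by
  have hc := (he.mdifferentiableAt_snd hs).hasMFDerivAt.comp s hγ.hasMFDerivAt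
  rw [he.form_eq_zero_iff _ hs]
  constructor
  · intro h
    have h0 : (mfderiv 𝓘(ℝ, EP) 𝓘(ℝ, EG) (fun y : P => (e y).2) (γ s)).comp
        (mfderiv 𝓘(ℝ, ℝ) 𝓘(ℝ, EP) γ s) = 0 := by
      ext
      exact h
    rw [h0] at hc
    exact hc
  · intro h
    exact DFunLike.congr_fun (hasMFDerivAt_unique hc h) (1 : ℝ)

end ConnectionForm.IsFlatTrivialization

/-! ### The leaf topology -/

/-- The total space `P` with the leaf topology of a flat connection. It is a structure, so that it
does not inherit the topology of `P`. -/
@[ext] structure LeafSpace (θ : ConnectionForm π) where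
  /-- the underlying point of the bundle -/
  toBundle : P

namespace LeafSpace

instance : MulAction G (LeafSpace θ) where
  smul g x := ⟨g • x.toBundle⟩
  one_smul x := LeafSpace.ext (one_smul G x.toBundle)
  mul_smul g h x := LeafSpace.ext (mul_smul g h x.toBundle)

/-- The projection of the leaf space to the base. -/
def proj (x : LeafSpace θ) : M := π.proj x.toBundle

/-- The section `m ↦ e⁻¹(m, a)` of the leaf space; it is meaningful only for `m ∈ e.baseSet`. -/
def slice (θ : ConnectionForm π) (e : Bundle.Trivialization G π.proj) (a : G) (m : M) :
    LeafSpace θ :=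
  ⟨e.toOpenPartialHomeomorph.symm (m, a)⟩

lemma proj_slice {m : M} (hm : m ∈ e.baseSet) (a : G) : proj (slice θ e a m) = m :=
  e.proj_symm_apply' hm

lemma slice_proj {x : LeafSpace θ} (hx : proj x ∈ e.baseSet) :
    slice θ e (e x.toBundle).2 (proj x) = x :=
  LeafSpace.ext (e.symm_apply_mk_proj (e.mem_source.2 hx))

/-- The leaf topology is the finest one for which the sections `m ↦ e⁻¹(m, a)` of all flat
trivializations `e` are continuous on their domains. -/
instance : TopologicalSpace (LeafSpace θ) where
  IsOpen U := ∀ e : Bundle.Trivialization G π.proj, θ.IsFlatTrivialization e → ∀ a : G,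
    IsOpen (e.baseSet ∩ slice θ e a ⁻¹' U)
  isOpen_univ e _ a := by simpa only [preimage_univ, inter_univ] using e.open_baseSet
  isOpen_inter U V hU hV e he a := by
    rw [preimage_inter, inter_inter_distrib_left]
    exact (hU e he a).inter (hV e he a)
  isOpen_sUnion 𝒰 h𝒰 e he a := by
    rw [preimage_sUnion, inter_iUnion₂]
    exact isOpen_biUnion fun U hU => h𝒰 U hU e he a

lemma isOpen_iff {U : Set (LeafSpace θ)} : IsOpen U ↔
    ∀ e : Bundle.Trivialization G π.proj, θ.IsFlatTrivialization e → ∀ a : G,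
      IsOpen (e.baseSet ∩ slice θ e a ⁻¹' U) := Iff.rfl

lemma continuous_toBundle : Continuous (toBundle : LeafSpace θ → P) :=
  ⟨fun _ hU e he a => (he.contMDiffOn_slice a).continuousOn.isOpen_inter_preimage
    e.open_baseSet hU⟩

/-- A continuous path in the bundle is continuous for the leaf topology where it stays in one slice
of a flat trivialization. -/
lemma continuousAt_of_eventually_eq {T : Type*} [TopologicalSpace T] {γ : T → LeafSpace θ} {t : T}
    (he : θ.IsFlatTrivialization e) (ht : proj (γ t) ∈ e.baseSet)
    (hγ : ContinuousAt (fun s => (γ s).toBundle) t)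
    (hc : ∀ᶠ s in 𝓝 t, (e (γ s).toBundle).2 = (e (γ t).toBundle).2) : ContinuousAt γ t := by
  have hpr : ContinuousAt (fun s => proj (γ s)) t :=
    π.smooth_proj.continuous.continuousAt.comp hγ
  rw [ContinuousAt, tendsto_nhds]
  intro U hU hUt
  have hm : proj (γ t) ∈ e.baseSet ∩ slice θ e (e (γ t).toBundle).2 ⁻¹' U :=
    ⟨ht, by rwa [mem_preimage, slice_proj ht]⟩
  filter_upwards [hc, hpr ((isOpen_iff.1 hU e he _).mem_nhds hm)] with s hs ⟨h1, h2⟩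
  rwa [← hs, mem_preimage, slice_proj h1] at h2

variable [IsManifold 𝓘(ℝ, EG) ∞ G] [IsManifold 𝓘(ℝ, EM) ∞ M]

lemma isOpen_slice (he : θ.IsFlatTrivialization e) (c : G) :
    IsOpen {x : LeafSpace θ | proj x ∈ e.baseSet ∧ (e x.toBundle).2 = c} := by
  intro e' he' a
  convert he.isOpen_transition he' a c using 1
  ext m
  constructor
  · rintro ⟨h1, h2, h3⟩
    rw [proj_slice h1] at h2
    exact ⟨⟨h2, h1⟩, h3⟩
  · rintro ⟨⟨h2, h1⟩, h3⟩
    exact ⟨h1, by rwa [proj_slice h1], h3⟩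

lemma isQuotientCoveringMap (hθ : θ.IsFlat) :
    IsQuotientCoveringMap (proj : LeafSpace θ → M) G where
  toIsQuotientMap := by
    refine ⟨Topology.isCoinducing_iff.2 fun U => ⟨fun hU => ?_, fun hU e he a => ?_⟩, fun m => ?_⟩
    · rw [isOpen_iff_mem_nhds]
      intro m hmU
      obtain ⟨e, hm, he⟩ := hθ.exists_isFlatTrivialization m
      filter_upwards [(hU e he 1).mem_nhds ⟨hm, by rwa [mem_preimage, mem_preimage, proj_slice hm]⟩]
        with u ⟨hu1, hu2⟩
      rwa [mem_preimage, mem_preimage, proj_slice hu1] at hu2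
    · convert e.open_baseSet.inter hU using 1
      ext m
      exact and_congr_right fun hm => by rw [mem_preimage, mem_preimage, proj_slice hm]
    · obtain ⟨e, hm, -⟩ := hθ.exists_isFlatTrivialization m
      exact ⟨slice θ e 1 m, proj_slice hm 1⟩
  continuous_const_smul g := by
    refine ⟨fun U hU e he a => ?_⟩
    convert hU e he (g * a) using 1
    ext m
    refine and_congr_right fun hm => ?_
    have : g • slice θ e a m = slice θ e (g * a) m := LeafSpace.ext (he.smul_symm_apply hm g a)
    simp only [mem_preimage, this]
  apply_eq_iff_mem_orbit := by
    intro x y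
    constructor
    · intro h
      obtain ⟨g, hg⟩ := π.exists_smul_eq h
      exact ⟨g, LeafSpace.ext hg⟩
    · rintro ⟨g, rfl⟩
      exact π.proj_smul g y.toBundle
  disjoint x := by
    obtain ⟨e, hm, he⟩ := hθ.exists_isFlatTrivialization (proj x)
    refine ⟨_, (isOpen_slice he (e x.toBundle).2).mem_nhds ⟨hm, rfl⟩, ?_⟩
    rintro g ⟨_, ⟨y, ⟨hy1, hy2⟩, rfl⟩, -, h⟩
    have := he.map_smul g y.toBundle (e.mem_source.2 hy1)
    rw [hy2] at this
    exact mul_eq_right.1 (this.symm.trans h)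

end LeafSpace

end Leaf

/-! ### Horizontal lifts and holonomy -/

section Holonomy

variable {EG : Type*} [NormedAddCommGroup EG] [NormedSpace ℝ EG]
  {G : Type*} [TopologicalSpace G] [ChartedSpace EG G] [Group G]
  {EP : Type*} [NormedAddCommGroup EP] [NormedSpace ℝ EP]
  {P : Type*} [TopologicalSpace P] [ChartedSpace EP P] [MulAction G P]
  {EM : Type*} [NormedAddCommGroup EM] [NormedSpace ℝ EM]
  {M : Type*} [TopologicalSpace M] [ChartedSpace EM M]
  {π : PrincipalBundle EG G EP P EM M} [IsManifold 𝓘(ℝ, EP) ∞ P] {θ : ConnectionForm π}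

namespace ConnectionForm

/-- A horizontal lift is continuous for the leaf topology. -/
lemma IsHorizontalLift.continuous_leafSpace [IsManifold 𝓘(ℝ, EG) ∞ G] [CompleteSpace EG]
    (hθ : θ.IsFlat) {m m' : M} {w : Path m m'} {x y : P} {γ : Path x y}
    (hγ : θ.IsHorizontalLift w γ) :
    Continuous fun t => (⟨γ t⟩ : LeafSpace θ) := by
  obtain ⟨S, hS, hd⟩ := hγ.piecewiseSmooth.exists_countable
  refine continuous_iff_continuousAt.2 fun t => ?_
  obtain ⟨e, hm, he⟩ := hθ.exists_isFlatTrivialization (π.proj (γ t))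
  refine LeafSpace.continuousAt_of_eventually_eq he hm γ.continuous.continuousAt ?_
  have hext : ∀ s : unitInterval, γ.extend s = γ s := fun s => γ.extend_apply s.2
  have hsrc : ∀ᶠ s in 𝓝 (t : ℝ), γ.extend s ∈ e.source := by
    refine γ.continuous_extend.continuousAt (e.open_source.mem_nhds ?_)
    rw [hext, e.mem_source]
    exact hm
  have key := eventually_eq_of_mfderiv_eq_zero_off_countable (F := EG)
    (f := fun u => (e (γ.extend u)).2) t.2 hS ?_ ?_
  · filter_upwards [continuous_subtype_val.continuousAt.eventually key] with s hs
    have := hs s.2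
    rwa [hext, hext] at this
  · filter_upwards [hsrc] with s hs
    exact (he.mdifferentiableAt_snd hs).continuousAt.comp γ.continuous_extend.continuousAt
  · filter_upwards [hsrc] with s hs hsS
    exact (he.form_eq_zero_iff_path (hd s hsS) hs).1 (hγ.horizontal s hsS.1 (hd s hsS))

variable [IsManifold 𝓘(ℝ, EG) ∞ G] [IsManifold 𝓘(ℝ, EM) ∞ M]

/-- A lift of a piecewise smooth path that is continuous for the leaf topology is horizontal. -/
lemma isHorizontalLift_of_continuous_leafSpace (hθ : θ.IsFlat) {m m' : M} {w : Path m m'}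
    (hw : IsPiecewiseSmooth EM w) {x y : P} {γ : Path x y}
    (hγ : Continuous fun t => (⟨γ t⟩ : LeafSpace θ)) (hlift : ∀ t, π.proj (γ t) = w t) :
    θ.IsHorizontalLift w γ := by
  have hΓ : Continuous fun s : ℝ => (⟨γ.extend s⟩ : LeafSpace θ) :=
    hγ.comp (continuous_projIcc (a := (0 : ℝ)) (b := 1) (h := zero_le_one))
  have hΓp : ∀ s, π.proj (γ.extend s) = w.extend s := fun s => hlift _
  -- Slices are open in the leaf space, so near each time the path stays in one slice.
  have key : ∀ s, ∃ e : Bundle.Trivialization G π.proj, θ.IsFlatTrivialization e ∧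
      γ.extend s ∈ e.source ∧ ∀ᶠ u in 𝓝 s, w.extend u ∈ e.baseSet ∧
        (e (γ.extend u)).2 = (e (γ.extend s)).2 := by
    intro s
    obtain ⟨e, hm, he⟩ := hθ.exists_isFlatTrivialization (π.proj (γ.extend s))
    refine ⟨e, he, e.mem_source.2 hm, ?_⟩
    filter_upwards [hΓ.continuousAt ((LeafSpace.isOpen_slice he _).mem_nhds ⟨hm, rfl⟩)]
      with u ⟨hu1, hu2⟩
    exact ⟨hΓp u ▸ hu1, hu2⟩
  refine ⟨?_, hlift, fun s _ hs => ?_⟩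
  · obtain ⟨n, t, ht, h0, h1, hs⟩ := hw
    refine ⟨n, t, ht, h0, h1, fun i hi s hsi => ?_⟩
    obtain ⟨e, he, hse, hev⟩ := key s
    have h2 : ContMDiffAt 𝓘(ℝ, EM) 𝓘(ℝ, EP) ∞
        (fun m => e.toOpenPartialHomeomorph.symm (m, (e (γ.extend s)).2)) (w.extend s) :=
      (he.contMDiffOn_slice _).contMDiffAt (e.open_baseSet.mem_nhds hev.self_of_nhds.1)
    have hev' : γ.extend =ᶠ[𝓝 s]
        fun u => e.toOpenPartialHomeomorph.symm (w.extend u, (e (γ.extend s)).2) := by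
      filter_upwards [hev] with u hu
      rw [← hu.2, ← hΓp u, e.symm_apply_mk_proj]
      rw [e.mem_source, hΓp u]
      exact hu.1
    exact (h2.comp_contMDiffWithinAt s (hs i hi s hsi)).congr_of_eventuallyEq
      (hev'.filter_mono nhdsWithin_le_nhds) hev'.self_of_nhds
  · obtain ⟨e, he, hse, hev⟩ := key s
    refine (he.form_eq_zero_iff_path hs hse).2 ?_
    exact (hasMFDerivAt_const (e (γ.extend s)).2 s).congr_of_eventuallyEq
      (hev.mono fun u hu => hu.2)

/-- The holonomy morphism of a flat connection: the class of a loop goes to the element of `G` that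
carries `x₀` to its image under the monodromy of the leaf space. The monodromy is a homomorphism from
Mathlib's fundamental group to `Gᵐᵒᵖ`, and the two reversals of order cancel. -/
noncomputable def holonomy (hθ : θ.IsFlat) {x₀ : P} {m₀ : M} (hx₀ : π.proj x₀ = m₀) :
    PiOne M m₀ →* G where
  toFun c := ((LeafSpace.isQuotientCoveringMap hθ).fundamentalGroupToMulOpposite
    ⟨⟨x₀⟩, hx₀⟩ c.unop).unop
  map_one' := congrArg MulOpposite.unop (map_one ((LeafSpace.isQuotientCoveringMap
    hθ).fundamentalGroupToMulOpposite ⟨⟨x₀⟩, hx₀⟩))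
  map_mul' c d := congrArg MulOpposite.unop (map_mul ((LeafSpace.isQuotientCoveringMap
    hθ).fundamentalGroupToMulOpposite ⟨⟨x₀⟩, hx₀⟩) d.unop c.unop)

lemma isHolonomy_holonomy [CompleteSpace EG] (hθ : θ.IsFlat) {x₀ : P} {m₀ : M}
    (hx₀ : π.proj x₀ = m₀) : θ.IsHolonomy x₀ m₀ (holonomy hθ hx₀) := by
  intro w hw
  have hp := LeafSpace.isQuotientCoveringMap hθ
  have hw0 : w 0 = LeafSpace.proj (⟨x₀⟩ : LeafSpace θ) := w.source.trans hx₀.symm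
  set Γ := hp.isCoveringMap.liftPath w ⟨x₀⟩ hw0 with hΓ
  have hend : holonomy hθ hx₀ (PiOne.mk w) • x₀ = (Γ 1).toBundle :=
    congrArg LeafSpace.toBundle (hp.unop_fundamentalGroupToMulOpposite_smul
      (e := ⟨⟨x₀⟩, hx₀⟩) (γ := FundamentalGroup.fromPath (Path.Homotopic.Quotient.mk w)))
  rw [hend]
  constructor
  · let γ : Path x₀ (Γ 1).toBundle :=
      { toFun := fun t => (Γ t).toBundle
        continuous_toFun := LeafSpace.continuous_toBundle.comp Γ.continuous
        source' := congrArg LeafSpace.toBundle (hp.isCoveringMap.liftPath_zero w _ hw0)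
        target' := rfl }
    exact ⟨γ, isHorizontalLift_of_continuous_leafSpace hθ hw (γ := γ) Γ.continuous
      fun t => congrFun (hp.isCoveringMap.liftPath_lifts w _ hw0) t⟩
  · intro y γ hγ
    have h : (⟨_, hγ.continuous_leafSpace hθ⟩ : C(unitInterval, LeafSpace θ)) = Γ :=
      (hp.isCoveringMap.eq_liftPath_iff' hw0).2
        ⟨funext hγ.lifts, LeafSpace.ext γ.source⟩
    rw [← h]
    exact γ.target.symm

end ConnectionForm

lemma PiOne.exists_isPiecewiseSmooth {E X : Type*} [NormedAddCommGroup E] [NormedSpace ℝ E]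
    [TopologicalSpace X] [ChartedSpace E X] [IsManifold 𝓘(ℝ, E) ∞ X] {x : X} (c : PiOne X x) :
    ∃ w : Path x x, IsPiecewiseSmooth E w ∧ PiOne.mk w = c := by
  obtain ⟨v, hv⟩ := Path.Homotopic.Quotient.mk_surjective c.unop
  obtain ⟨w, hw, hvw⟩ := exists_homotopic_isPiecewiseSmooth (E := E) v
  refine ⟨w, hw, MulOpposite.unop_injective ?_⟩
  exact (Path.Homotopic.Quotient.eq.2 hvw.symm).trans hv

namespace ConnectionForm

variable [IsManifold 𝓘(ℝ, EM) ∞ M]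

lemma IsHolonomy.unique {x₀ : P} {m₀ : M} {h h' : PiOne M m₀ →* G}
    (hh : θ.IsHolonomy x₀ m₀ h) (hh' : θ.IsHolonomy x₀ m₀ h') : h = h' := by
  ext c
  obtain ⟨w, hw, rfl⟩ := PiOne.exists_isPiecewiseSmooth (E := EM) c
  obtain ⟨γ, hγ⟩ := (hh w hw).1
  exact π.smul_left_injective x₀ ((hh' w hw).2 _ γ hγ)

lemma IsFlat.existsUnique_isHolonomy [IsManifold 𝓘(ℝ, EG) ∞ G] [CompleteSpace EG]
    (hθ : θ.IsFlat) {x₀ : P} {m₀ : M} (hx₀ : π.proj x₀ = m₀) :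
    ∃! h : PiOne M m₀ →* G, θ.IsHolonomy x₀ m₀ h :=
  ⟨holonomy hθ hx₀, isHolonomy_holonomy hθ hx₀,
    fun _ hh => hh.unique (isHolonomy_holonomy hθ hx₀)⟩

end ConnectionForm

/-! ### The induced connection -/

section Induced

variable {M' : Type*} [TopologicalSpace M'] [ChartedSpace EM M'] {q : SmoothCovering EM M' M}

lemma ConnectionForm.IsFlatTrivialization.induced {e : Bundle.Trivialization G π.proj}
    (he : θ.IsFlatTrivialization e) (z₀ : InducedBundle π q) :
    (θ.induced q).IsFlatTrivialization (InducedBundle.trivialization q z₀ e) where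
  toIsPrincipalTrivialization :=
    InducedBundle.isPrincipalTrivialization z₀ he.toIsPrincipalTrivialization
  form_eq_zero_iff z hz v := by
    have hz' : z.toBundle ∈ e.source := by
      rw [e.mem_source, z.comm]
      exact hz
    have hc := mfderiv_comp z (he.mdifferentiableAt_snd hz')
      ((InducedBundle.smooth_toBundle π q z).mdifferentiableAt (by simp))
    refine (he.form_eq_zero_iff _ hz' _).trans ?_
    exact (DFunLike.congr_fun hc v) ▸ Iff.rfl

lemma ConnectionForm.IsFlat.induced (hθ : θ.IsFlat) (q : SmoothCovering EM M' M) :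
    (θ.induced q).IsFlat := by
  intro m
  obtain ⟨e, hm, he⟩ := hθ.exists_isFlatTrivialization (q.toContinuousMap m)
  let z₀ : InducedBundle π q :=
    ⟨m, e.toOpenPartialHomeomorph.symm (q.toContinuousMap m, 1), e.proj_symm_apply' hm⟩
  have h := he.induced z₀
  exact ⟨_, hm, h.toIsPrincipalTrivialization, h.form_eq_zero_iff⟩

lemma ConnectionForm.IsHorizontalLift.map_toBundle {m m' : M'} {w : Path m m'}
    {z z' : InducedBundle π q} {γ : Path z z'} (hγ : (θ.induced q).IsHorizontalLift w γ) :
    θ.IsHorizontalLift (w.map q.toContinuousMap.continuous)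
      (γ.map (InducedBundle.smooth_toBundle π q).continuous) where
  piecewiseSmooth := hγ.piecewiseSmooth.map (InducedBundle.smooth_toBundle π q)
  lifts t := (γ t).comm.trans (congrArg q.toContinuousMap (hγ.lifts t))
  horizontal s hs hd := by
    -- The canonical map is a local diffeomorphism, so the path upstairs is differentiable wherever
    -- its image is.
    have hd' : MDifferentiableAt 𝓘(ℝ, ℝ) 𝓘(ℝ, EP) γ.extend s := by
      obtain ⟨Φ, hx, hΦ⟩ :=
        InducedBundle.isLocalDiffeomorph_toBundle (π := π) (q := q) (γ.extend s)
      have h1 : MDifferentiableAt 𝓘(ℝ, EP) 𝓘(ℝ, EP) Φ.symm (γ.extend s).toBundle := by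
        refine (Φ.symm.contMDiffOn.contMDiffAt (Φ.open_target.mem_nhds ?_)).mdifferentiableAt
          (by simp)
        rw [hΦ hx]
        exact Φ.map_source hx
      refine (h1.comp s hd).congr_of_eventuallyEq ?_
      filter_upwards [γ.continuous_extend.continuousAt (Φ.open_source.mem_nhds hx)] with u hu
      have h2 : Φ.symm (Φ (γ.extend u)) = γ.extend u := Φ.left_inv hu
      rw [← hΦ hu] at h2
      exact h2.symm
    have hc := mfderiv_comp s
      ((InducedBundle.smooth_toBundle π q (γ.extend s)).mdifferentiableAt (by simp)) hd'
    refine Eq.trans ?_ (hγ.horizontal s hs hd')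
    exact congrArg (θ.form (γ.extend s).toBundle) (DFunLike.congr_fun hc (1 : ℝ))

end Induced

end Holonomy

end FlatHolonomy

open FlatHolonomy in
theorem proposition1p2
    {EG : Type*} [NormedAddCommGroup EG] [NormedSpace ℝ EG] [FiniteDimensional ℝ EG]
    {G : Type*} [TopologicalSpace G] [ChartedSpace EG G] [Group G] [LieGroup 𝓘(ℝ, EG) ∞ G]
    {EP : Type*} [NormedAddCommGroup EP] [NormedSpace ℝ EP] [FiniteDimensional ℝ EP]
    {P : Type*} [TopologicalSpace P] [ChartedSpace EP P] [IsManifold 𝓘(ℝ, EP) ∞ P]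
    [T2Space P] [ParacompactSpace P] [ConnectedSpace P] [MulAction G P]
    {EM : Type*} [NormedAddCommGroup EM] [NormedSpace ℝ EM] [FiniteDimensional ℝ EM]
    {M : Type*} [TopologicalSpace M] [ChartedSpace EM M] [IsManifold 𝓘(ℝ, EM) ∞ M]
    [T2Space M] [ParacompactSpace M] [ConnectedSpace M]
    {M' : Type*} [TopologicalSpace M'] [ChartedSpace EM M'] [IsManifold 𝓘(ℝ, EM) ∞ M']
    (π : PrincipalBundle EG G EP P EM M) (θ : ConnectionForm π) (hθ : θ.IsFlat)
    (q : SmoothCovering EM M' M) (z₀ : InducedBundle π q) :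
    (θ.induced q).IsFlat ∧
    (∃! h : PiOne M (q.toContinuousMap z₀.toBase) →* G, θ.IsHolonomy z₀.toBundle _ h) ∧
    (∃! h' : PiOne M' z₀.toBase →* G, (θ.induced q).IsHolonomy z₀ _ h') ∧
    ∀ (h : PiOne M (q.toContinuousMap z₀.toBase) →* G) (h' : PiOne M' z₀.toBase →* G),
      θ.IsHolonomy z₀.toBundle _ h → (θ.induced q).IsHolonomy z₀ _ h' →
      h' = h.comp (PiOne.map q.toContinuousMap z₀.toBase) := by
  have := FiniteDimensional.complete ℝ EG
  refine ⟨hθ.induced q, hθ.existsUnique_isHolonomy z₀.comm,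
    (hθ.induced q).existsUnique_isHolonomy rfl, fun h h' hh hh' => ?_⟩
  ext c
  obtain ⟨w, hw, rfl⟩ := PiOne.exists_isPiecewiseSmooth (E := EM) c
  obtain ⟨γ, hγ⟩ := (hh' w hw).1
  refine π.smul_left_injective z₀.toBundle ?_
  exact (hh _ (hw.map q.isLocalDiffeomorph.contMDiff)).2 _ _ hγ.map_toBundle
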